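/- Let $M$ be a smooth $3$-dimensional manifold with a smooth Riemannian metric $g$ and Levi-Civita connection $\nabla$. Write $R(X,Y)Z=\nabla_X\nabla_YZ-\nabla_Y\nabla_XZ-\nabla_{[X,Y]}Z$, $R(X,Y,Z,W)=g(R(X,Y)Z,W)$, $\mathrm{Ric}(X,Y)=\operatorname{tr}(Z\mapsto R(Z,X)Y)$, let $Q$ be the Ricci operator, $g(QX,Y)=\mathrm{Ric}(X,Y)$, and let $\tau=\operatorname{tr}Q$ be the scalar curvature. Let $\phi$ be a smooth $(1,1)$-tensor field, $\xi$ a smooth vector field and $\eta$ a smooth $1$-form on $M$ such that $(\phi,\xi,\eta,g)$ is a contact metric structure, that is, $$\eta(\xi)=1,\qquad \phi^2X=-X+\eta(X)\xi,\qquad g(\phi X,\phi Y)=g(X,Y)-\eta(X)\eta(Y),\qquad d\eta(X,Y)=g(X,\phi Y),$$ where $d\eta(X,Y)=\tfrac12\big(X\eta(Y)-Y\eta(X)-\eta([X,Y])\big)$. Let $h=\tfrac12 L_\xi\phi$, i.e. $2hX=[\xi,\phi X]-\phi[\xi,X]$. Suppose that $M$ is a $(\kappa,\mu,\nu)$-contact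 metric manifold: there are smooth functions $\kappa,\mu,\nu:M\to\mathbb R$ with $$R(X,Y)\xi=\kappa\{\eta(Y)X-\eta(X)Y\}+\mu\{\eta(Y)hX-\eta(X)hY\}+\nu\{\eta(Y)\phi hX-\eta(X)\phi hY\}$$ for all $X,Y$. Suppose also that $\kappa<1$ everywhere on $M$. Then the $\phi$-sectional curvature of $M$ is $F=\frac{\tau}{2}-2\kappa$: for every $p\in M$ and every unit vector $X\in T_pM$ orthogonal to $\xi_p$, $$R(X,\phi X,\phi X,X)=\frac{\tau(p)}{2}-2\kappa(p).$$ -/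

import Mathlib

open scoped Manifold ContDiff Bundle

noncomputable section

namespace ContactMetric

variable {n : ℕ} {M : Type*} [TopologicalSpace M]
  [ChartedSpace (EuclideanSpace ℝ (Fin n)) M]

/-- (Not necessarily continuous) vector fields on the `n`-dimensional manifold `M`. -/
abbrev VField (n : ℕ) (M : Type*) [TopologicalSpace M]
    [ChartedSpace (EuclideanSpace ℝ (Fin n)) M] : Type _ :=
  (p : M) → TangentSpace (𝓡 n) p

/-- (Not necessarily continuous) 1-forms on `M`. -/
abbrev OneForm (n : ℕ) (M : Type*) [TopologicalSpace M]
    [ChartedSpace (EuclideanSpace ℝ (Fin n)) M] : Type _ :=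
  (p : M) → TangentSpace (𝓡 n) p →L[ℝ] ℝ

/-- (Not necessarily continuous) (1,1)-tensor fields on `M`, i.e. fields of endomorphisms of the
tangent spaces. -/
abbrev EndField (n : ℕ) (M : Type*) [TopologicalSpace M]
    [ChartedSpace (EuclideanSpace ℝ (Fin n)) M] : Type _ :=
  (p : M) → TangentSpace (𝓡 n) p →L[ℝ] TangentSpace (𝓡 n) p

/-- The derivative `X f` of a function `f` along a vector field `X`. -/
def dirDeriv (X : VField n M) (f : M → ℝ) (p : M) : ℝ :=
  mfderiv (𝓡 n) 𝓘(ℝ, ℝ) f p (X p)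

section Smooth

variable [IsManifold (𝓡 n) ∞ M]

/-- The extension of a tangent vector `v` at `p` to a vector field which, near `p`, is smooth: it
has constant components in the preferred chart at `p`. It serves to evaluate tensors that are
defined through vector fields on tangent vectors; the values of these tensors at `p` do not
depend on the extension. -/
def extendVec {p : M} (v : TangentSpace (𝓡 n) p) : VField n M :=
  FiberBundle.extend (EuclideanSpace ℝ (Fin n)) v

/-- A smooth vector field. -/
def SmoothVField (X : VField n M) : Prop :=
  ContMDiff (𝓡 n) ((𝓡 n).prod 𝓘(ℝ, EuclideanSpace ℝ (Fin n))) ∞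
    (fun p : M => Bundle.TotalSpace.mk' (EuclideanSpace ℝ (Fin n))
      (E := fun q : M => TangentSpace (𝓡 n) q) p (X p))

/-- A smooth 1-form. -/
def SmoothOneForm (η : OneForm n M) : Prop :=
  ContMDiff (𝓡 n) ((𝓡 n).prod 𝓘(ℝ, EuclideanSpace ℝ (Fin n) →L[ℝ] ℝ)) ∞
    (fun p : M => Bundle.TotalSpace.mk' (EuclideanSpace ℝ (Fin n) →L[ℝ] ℝ)
      (E := fun q : M => TangentSpace (𝓡 n) q →L[ℝ] ℝ) p (η p))

/-- A smooth (1,1)-tensor field. -/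
def SmoothEndField (φ : EndField n M) : Prop :=
  ContMDiff (𝓡 n)
    ((𝓡 n).prod 𝓘(ℝ, EuclideanSpace ℝ (Fin n) →L[ℝ] EuclideanSpace ℝ (Fin n))) ∞
    (fun p : M => Bundle.TotalSpace.mk'
      (EuclideanSpace ℝ (Fin n) →L[ℝ] EuclideanSpace ℝ (Fin n))
      (E := fun q : M => TangentSpace (𝓡 n) q →L[ℝ] TangentSpace (𝓡 n) q) p (φ p))

/-- The exterior derivative of a 1-form, with the convention
`2 dη(X, Y) = X (η Y) - Y (η X) - η [X, Y]` that is usual in contact metric geometry. -/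
def dOneForm (η : OneForm n M) (p : M) (x y : TangentSpace (𝓡 n) p) : ℝ :=
  (1 / 2 : ℝ) * (dirDeriv (extendVec x) (fun q => η q (extendVec y q)) p
    - dirDeriv (extendVec y) (fun q => η q (extendVec x q)) p
    - η p (VectorField.mlieBracket (𝓡 n) (extendVec x) (extendVec y) p))

/-- The tensor `h = (1/2) L_ξ φ`, that is `2 h X = [ξ, φ X] - φ [ξ, X]`. -/
def hTensor (φ : EndField n M) (ξ : VField n M) (p : M) (x : TangentSpace (𝓡 n) p) :
    TangentSpace (𝓡 n) p :=
  (1 / 2 : ℝ) • (VectorField.mlieBracket (𝓡 n) ξ (fun q => φ q (extendVec x q)) p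
    - φ p (VectorField.mlieBracket (𝓡 n) ξ (extendVec x) p))

section Riemannian

variable [Bundle.RiemannianBundle (fun p : M => TangentSpace (𝓡 n) p)]

instance (p : M) : FiniteDimensional ℝ (TangentSpace (𝓡 n) p) :=
  inferInstanceAs (FiniteDimensional ℝ (EuclideanSpace ℝ (Fin n)))

/-- The function `g(X, Y)` for the Riemannian metric `g` of `M`. -/
def metricFun (X Y : VField n M) (p : M) : ℝ := inner ℝ (X p) (Y p)

/-- The right hand side of the Koszul formula, which is `2 g(∇_X Y, Z)` for the Levi-Civita
connection `∇`. -/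
def koszul (X Y Z : VField n M) (p : M) : ℝ :=
  dirDeriv X (metricFun Y Z) p + dirDeriv Y (metricFun Z X) p - dirDeriv Z (metricFun X Y) p
    + metricFun (VectorField.mlieBracket (𝓡 n) X Y) Z p
    - metricFun (VectorField.mlieBracket (𝓡 n) Y Z) X p
    + metricFun (VectorField.mlieBracket (𝓡 n) Z X) Y p

/-- An orthonormal basis of the tangent space at `p`. -/
def onb (p : M) :
    OrthonormalBasis (Fin (Module.finrank ℝ (TangentSpace (𝓡 n) p))) ℝ (TangentSpace (𝓡 n) p) :=
  stdOrthonormalBasis ℝ (TangentSpace (𝓡 n) p)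

/-- The covariant derivative `∇_X Y` of the Levi-Civita connection: the vector field with
`2 g(∇_X Y, Z) = koszul X Y Z` for all `Z`, written out in an orthonormal basis. -/
def leviCivita (X Y : VField n M) : VField n M := fun p =>
  ∑ i, ((1 / 2 : ℝ) * koszul X Y (extendVec (onb p i)) p) • onb p i

/-- `R(X, Y) Z = ∇_X ∇_Y Z - ∇_Y ∇_X Z - ∇_[X, Y] Z` for vector fields. -/
def curvField (X Y Z : VField n M) : VField n M :=
  leviCivita X (leviCivita Y Z) - leviCivita Y (leviCivita X Z)
    - leviCivita (VectorField.mlieBracket (𝓡 n) X Y) Z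

/-- The Riemann curvature tensor `R(x, y) z` on tangent vectors at `p`. -/
def curv (p : M) (x y z : TangentSpace (𝓡 n) p) : TangentSpace (𝓡 n) p :=
  curvField (extendVec x) (extendVec y) (extendVec z) p

/-- The curvature tensor `R(x, y, z, w) = g(R(x, y) z, w)`. -/
def curv4 (p : M) (x y z w : TangentSpace (𝓡 n) p) : ℝ := inner ℝ (curv p x y z) w

/-- The Ricci tensor `Ric(x, y) = tr (z ↦ R(z, x) y)`. -/
def ricci (p : M) (x y : TangentSpace (𝓡 n) p) : ℝ :=
  ∑ i, curv4 p (onb p i) x y (onb p i)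

/-- The Ricci operator `Q`, with `g(Q x, y) = Ric(x, y)`. -/
def ricciOp (p : M) (x : TangentSpace (𝓡 n) p) : TangentSpace (𝓡 n) p :=
  ∑ i, ricci p x (onb p i) • onb p i

variable (n) in
/-- The scalar curvature `τ = tr Q`. -/
def scalarCurv (p : M) : ℝ :=
  ∑ i, inner ℝ (ricciOp (n := n) p (onb p i)) (onb p i)

/-- The `φ`-sectional curvature `K(x, φ x) = R(x, φ x, φ x, x)` of the plane spanned by `x` and
`φ x`; here `x` is a unit tangent vector at `p` orthogonal to the structure vector field. -/
def phiSectionalCurv (φ : EndField n M) (p : M) (x : TangentSpace (𝓡 n) p) : ℝ :=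
  curv4 p x (φ p x) (φ p x) x

/-- `(φ, ξ, η, g)` is an almost contact metric structure on `M`, where `g` is the Riemannian
metric of `M`. -/
structure IsAlmostContactMetric (φ : EndField n M) (ξ : VField n M) (η : OneForm n M) :
    Prop where
  smooth_phi : SmoothEndField φ
  smooth_xi : SmoothVField ξ
  smooth_eta : SmoothOneForm η
  eta_xi : ∀ p, η p (ξ p) = 1
  phi_sq : ∀ p x, φ p (φ p x) = -x + η p x • ξ p
  metric_phi : ∀ p (x y : TangentSpace (𝓡 n) p),
    inner ℝ (φ p x) (φ p y) = inner ℝ x y - η p x * η p y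

/-- `(φ, ξ, η, g)` is a contact metric structure: `dη(X, Y) = Φ(X, Y) = g(X, φ Y)`. -/
structure IsContactMetric (φ : EndField n M) (ξ : VField n M) (η : OneForm n M) : Prop
    extends IsAlmostContactMetric φ ξ η where
  d_eta : ∀ p (x y : TangentSpace (𝓡 n) p), dOneForm η p x y = inner ℝ x (φ p y)

/-- `(φ, ξ, η, g)` is a `(κ, μ, ν)`-contact metric structure. -/
structure IsKappaMuNu (φ : EndField n M) (ξ : VField n M) (η : OneForm n M)
    (κ μ ν : M → ℝ) : Prop extends IsContactMetric φ ξ η where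
  smooth_kappa : ContMDiff (𝓡 n) 𝓘(ℝ, ℝ) ∞ κ
  smooth_mu : ContMDiff (𝓡 n) 𝓘(ℝ, ℝ) ∞ μ
  smooth_nu : ContMDiff (𝓡 n) 𝓘(ℝ, ℝ) ∞ ν
  curv_xi : ∀ p (x y : TangentSpace (𝓡 n) p),
    curv p x y (ξ p) =
      κ p • (η p y • x - η p x • y)
      + μ p • (η p y • hTensor φ ξ p x - η p x • hTensor φ ξ p y)
      + ν p • (η p y • φ p (hTensor φ ξ p x) - η p x • φ p (hTensor φ ξ p y))

end Riemannian

end Smooth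

end ContactMetric

end

/-! For a unit vector `x` orthogonal to `ξ p`, the vectors `x`, `φ x`, `ξ` form an orthonormal basis
of the tangent space, so `τ` is twice the sum of the sectional curvatures of the three coordinate
planes: `τ = 2 (F + K(x, ξ) + K(φ x, ξ))`. The formula for `R(X, Y) ξ` gives `K(y, ξ) = κ + μ g(h y,
y) + ν g(φ h y, y)` for unit `y` orthogonal to `ξ`. Modulo `ξ`, `h` anticommutes with `φ`
(`hTensor_phi`), so the `μ` and `ν` terms for `y = φ x` are opposite to those for `y = x`. Hence
`K(x, ξ) + K(φ x, ξ) = 2κ` and `τ = 2F + 4κ`.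

Most of the work is to derive, from the Koszul formula, the facts that let `τ` be computed in this
basis (`scalarCurv_eq_sum`): linearity of `R` in its first argument, which makes the Ricci tensor a
trace, and skew-symmetry of `R` in the first and in the last pair of arguments. The latter rests on
metric compatibility (`dirDeriv_metricFun`) and on brackets acting as commutators of derivations
(`dirDeriv_mlieBracket`). -/

noncomputable section

namespace ContactMetric

open Filter Topology VectorField

/-! ### Derivations, Lie brackets and local extensions of tangent vectors. -/

section Fields

variable {n : ℕ} {M : Type*} [TopologicalSpace M]
  [ChartedSpace (EuclideanSpace ℝ (Fin n)) M]

/-- A function on `M` is differentiable at `p`. -/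
abbrev FunDiffAt (n : ℕ) {M : Type*} [TopologicalSpace M]
    [ChartedSpace (EuclideanSpace ℝ (Fin n)) M] (f : M → ℝ) (p : M) : Prop :=
  MDifferentiableAt (𝓡 n) 𝓘(ℝ, ℝ) f p

/-- A function on `M` is of class `C^k` at `p`. -/
abbrev FunContDiffAt (n : ℕ) {M : Type*} [TopologicalSpace M]
    [ChartedSpace (EuclideanSpace ℝ (Fin n)) M] (k : WithTop ℕ∞) (f : M → ℝ) (p : M) : Prop :=
  ContMDiffAt (𝓡 n) 𝓘(ℝ, ℝ) k f p

section Derivations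

variable {X Y : VField n M} {f g : M → ℝ} {p : M}

theorem dirDeriv_eq_mvfderiv (X : VField n M) (f : M → ℝ) (p : M) :
    dirDeriv X f p = mvfderiv (𝓡 n) f p (X p) := rfl

theorem dirDeriv_add (hf : FunDiffAt n f p) (hg : FunDiffAt n g p) :
    dirDeriv X (f + g) p = dirDeriv X f p + dirDeriv X g p := by
  simp only [dirDeriv_eq_mvfderiv, mvfderiv_add hf hg, add_apply]

theorem dirDeriv_mul (hf : FunDiffAt n f p) (hg : FunDiffAt n g p) :
    dirDeriv X (f * g) p = f p * dirDeriv X g p + g p * dirDeriv X f p := by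
  simp only [dirDeriv_eq_mvfderiv, mvfderiv_mul hf hg, add_apply,
    smul_apply, smul_eq_mul]

theorem dirDeriv_const (c : ℝ) : dirDeriv X (fun _ => c) p = 0 := by
  simp only [dirDeriv_eq_mvfderiv, mvfderiv_const]; rfl

theorem dirDeriv_add_left : dirDeriv (X + Y) f p = dirDeriv X f p + dirDeriv Y f p :=
  map_add (mfderiv (𝓡 n) 𝓘(ℝ, ℝ) f p) (X p) (Y p)

theorem dirDeriv_smul_left : dirDeriv (g • X) f p = g p * dirDeriv X f p :=
  map_smul (mfderiv (𝓡 n) 𝓘(ℝ, ℝ) f p) (g p) (X p)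

theorem dirDeriv_congr (h : f =ᶠ[𝓝 p] g) : dirDeriv X f p = dirDeriv X g p := by
  simp only [dirDeriv, h.mfderiv_eq]; rfl

theorem FunContDiffAt.eventually {k : ℕ} [IsManifold (𝓡 n) k M] (h : FunContDiffAt n k f p) :
    ∀ᶠ q in 𝓝 p, FunContDiffAt n k f q :=
  (contMDiffAt_iff_contMDiffAt_nhds (by simp)).1 h

end Derivations

variable [IsManifold (𝓡 n) ∞ M]

/-- A vector field on `M` is differentiable at `p`. -/
abbrev VFieldDiffAt (X : VField n M) (p : M) : Prop :=
  MDifferentiableAt (𝓡 n) ((𝓡 n).prod 𝓘(ℝ, EuclideanSpace ℝ (Fin n)))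
    (fun q : M => Bundle.TotalSpace.mk' (EuclideanSpace ℝ (Fin n))
      (E := fun q : M => TangentSpace (𝓡 n) q) q (X q)) p

/-- A vector field on `M` is of class `C^k` at `p`. -/
abbrev VFieldContDiffAt (k : WithTop ℕ∞) (X : VField n M) (p : M) : Prop :=
  ContMDiffAt (𝓡 n) ((𝓡 n).prod 𝓘(ℝ, EuclideanSpace ℝ (Fin n))) k
    (fun q : M => Bundle.TotalSpace.mk' (EuclideanSpace ℝ (Fin n))
      (E := fun q : M => TangentSpace (𝓡 n) q) q (X q)) p

variable {X Y : VField n M} {f g : M → ℝ} {p : M}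

theorem VFieldContDiffAt.eventually (h : VFieldContDiffAt 2 X p) :
    ∀ᶠ q in 𝓝 p, VFieldContDiffAt 2 X q :=
  (contMDiffAt_iff_contMDiffAt_nhds (by simp)).1 h

theorem VFieldContDiffAt.diffAt (h : VFieldContDiffAt 2 X p) : VFieldDiffAt X p :=
  h.mdifferentiableAt two_ne_zero

theorem VFieldDiffAt.add (hX : VFieldDiffAt X p) (hY : VFieldDiffAt Y p) :
    VFieldDiffAt (X + Y) p :=
  mdifferentiableAt_add_section hX hY

theorem VFieldDiffAt.smul (hf : FunDiffAt n f p) (hX : VFieldDiffAt X p) :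
    VFieldDiffAt (f • X) p :=
  MDifferentiableAt.smul_section hf hX

theorem VFieldContDiffAt.smul (hf : FunContDiffAt n 2 f p) (hX : VFieldContDiffAt 2 X p) :
    VFieldContDiffAt 2 (f • X) p :=
  ContMDiffAt.smul_section hf hX

theorem diffAt_mlieBracket (hX : VFieldContDiffAt 2 X p) (hY : VFieldContDiffAt 2 Y p) :
    VFieldDiffAt (mlieBracket (𝓡 n) X Y) p := by
  have : IsManifold (𝓡 n) (((2 : ℕ∞) : WithTop ℕ∞) + 1) M := IsManifold.of_le (n := ∞) (by
    exact_mod_cast le_top)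
  have : IsManifold (𝓡 n) (minSmoothness ℝ 2) M := by
    simp only [minSmoothness_of_isRCLikeNormedField]; infer_instance
  exact (ContMDiffAt.mlieBracket_vectorField (m := 1) (n := 2) hX hY
    (by simp; norm_num)).mdifferentiableAt one_ne_zero

theorem diffAt_dirDeriv (hX : VFieldDiffAt X p) (hf : FunContDiffAt n 2 f p) :
    FunDiffAt n (dirDeriv X f) p := by
  have h1 := (hf.mfderiv_const (m := 1) (by norm_num)).mdifferentiableAt one_ne_zero
  have h2 : FunDiffAt n f p := hf.mdifferentiableAt two_ne_zero
  have h3 := MDifferentiableAt.clm_apply_of_inCoordinates (F₁ := EuclideanSpace ℝ (Fin n))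
    (E₁ := TangentSpace (𝓡 n)) (F₂ := ℝ) (E₂ := TangentSpace 𝓘(ℝ, ℝ)) (IB₁ := 𝓡 n)
    (IB₂ := 𝓘(ℝ, ℝ)) (b₁ := id) (b₂ := f)
    (ϕ := fun q => mfderiv (𝓡 n) 𝓘(ℝ, ℝ) f q) (v := X) h1 hX h2
  rw [mdifferentiableAt_totalSpace] at h3
  have h4 := h3.2
  simp at h4
  exact h4

theorem mlieBracket_smul_right' (hf : FunDiffAt n f p) (hY : VFieldDiffAt Y p) :
    mlieBracket (𝓡 n) X (f • Y) p =
      dirDeriv X f p • Y p + f p • mlieBracket (𝓡 n) X Y p :=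
  mlieBracket_smul_right hf hY

theorem mlieBracket_smul_left' (hf : FunDiffAt n f p) (hX : VFieldDiffAt X p) :
    mlieBracket (𝓡 n) (f • X) Y p =
      - dirDeriv Y f p • X p + f p • mlieBracket (𝓡 n) X Y p :=
  mlieBracket_smul_left hf hX

theorem eventuallyEq_mlieBracket_smul_right (hf : FunContDiffAt n 2 f p)
    (hY : VFieldContDiffAt 2 Y p) :
    mlieBracket (𝓡 n) X (f • Y) =ᶠ[𝓝 p] dirDeriv X f • Y + f • mlieBracket (𝓡 n) X Y := by
  filter_upwards [hY.eventually, FunContDiffAt.eventually (k := 2) hf] with q h1 h2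
  exact mlieBracket_smul_right' (h2.mdifferentiableAt two_ne_zero) h1.diffAt

/-- The Leibniz identity for the brackets of `X`, `Y` and `f • W`, in which the terms with
brackets of `W` cancel. -/
theorem dirDeriv_mlieBracket_smul {W : VField n M} (hX : VFieldContDiffAt 2 X p)
    (hY : VFieldContDiffAt 2 Y p) (hW : VFieldContDiffAt 2 W p) (hf : FunContDiffAt n 2 f p) :
    dirDeriv (mlieBracket (𝓡 n) X Y) f p • W p =
      (dirDeriv X (dirDeriv Y f) p - dirDeriv Y (dirDeriv X f) p) • W p := by
  have hm : IsManifold (𝓡 n) (minSmoothness ℝ 3) M := by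
    simp only [minSmoothness_of_isRCLikeNormedField]; infer_instance
  have hs : minSmoothness ℝ 2 = 2 := minSmoothness_of_isRCLikeNormedField
  have hfW : VFieldContDiffAt 2 (f • W) p := VFieldContDiffAt.smul hf hW
  have hfd : FunDiffAt n f p := hf.mdifferentiableAt two_ne_zero
  have J := leibniz_identity_mlieBracket_apply (hs ▸ hX) (hs ▸ hY) (hs ▸ hW)
  have K := leibniz_identity_mlieBracket_apply (hs ▸ hX) (hs ▸ hY) (hs ▸ hfW)
  have e (A : VField n M) := eventuallyEq_mlieBracket_smul_right (X := A) hf hW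
  have expand {A B : VField n M} (hA : VFieldContDiffAt 2 A p) (hB : VFieldContDiffAt 2 B p) :
      mlieBracket (𝓡 n) A (mlieBracket (𝓡 n) B (f • W)) p =
        dirDeriv A (dirDeriv B f) p • W p + dirDeriv B f p • mlieBracket (𝓡 n) A W p
        + (dirDeriv A f p • mlieBracket (𝓡 n) B W p
          + f p • mlieBracket (𝓡 n) A (mlieBracket (𝓡 n) B W) p) := by
    have hBf := diffAt_dirDeriv hB.diffAt hf
    have hBW := diffAt_mlieBracket hB hW
    rw [EventuallyEq.mlieBracket_vectorField_eq (EventuallyEq.refl (𝓝 p) A) (e B),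
      mlieBracket_add_right (VFieldDiffAt.smul hBf hW.diffAt)
        (VFieldDiffAt.smul hfd hBW),
      mlieBracket_smul_right' hBf hW.diffAt, mlieBracket_smul_right' hfd hBW]
  rw [expand hX hY, expand hY hX, mlieBracket_smul_right' hfd hW.diffAt, J] at K
  linear_combination (norm := module) -K

/-- The bracket of vector fields acts on functions as the commutator of derivations. -/
theorem dirDeriv_mlieBracket (hX : VFieldContDiffAt 2 X p) (hY : VFieldContDiffAt 2 Y p)
    (hf : FunContDiffAt n 2 f p) :
    dirDeriv (mlieBracket (𝓡 n) X Y) f p =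
      dirDeriv X (dirDeriv Y f) p - dirDeriv Y (dirDeriv X f) p := by
  -- A nonzero `w` lets the vector be cancelled from the Leibniz identity; if the tangent space is
  -- zero, all directional derivatives at `p` vanish.
  by_cases h : ∃ w : TangentSpace (𝓡 n) p, w ≠ 0
  · obtain ⟨w, hw⟩ := h
    have := dirDeriv_mlieBracket_smul hX hY
      (FiberBundle.contMDiffAt_extend (𝓡 n) (EuclideanSpace ℝ (Fin n)) w) hf
    rw [FiberBundle.extend_apply_self] at this
    exact smul_left_injective ℝ hw this
  · push Not at h
    have h0 (Z : VField n M) (u : M → ℝ) : dirDeriv Z u p = 0 := by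
      rw [dirDeriv, h (Z p), map_zero]; rfl
    simp only [h0, sub_zero]

@[simp]
theorem extendVec_self (v : TangentSpace (𝓡 n) p) : extendVec v p = v :=
  FiberBundle.extend_apply_self _ v

theorem contDiffAt_extendVec (v : TangentSpace (𝓡 n) p) : VFieldContDiffAt 2 (extendVec v) p :=
  FiberBundle.contMDiffAt_extend (𝓡 n) _ v

theorem diffAt_extendVec (v : TangentSpace (𝓡 n) p) : VFieldDiffAt (extendVec v) p :=
  (contDiffAt_extendVec v).diffAt

/-- Inside the base set of the trivialization at `p`, extending means reading `v` in the
trivialization and transporting it to the fibre at `q`, and both maps are linear. Additivity and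
homogeneity of `extendVec` are therefore available only as germs at `p`. -/
theorem eventually_extendVec_eq (p : M) :
    ∀ᶠ q in 𝓝 p, ∃ L : TangentSpace (𝓡 n) p →ₗ[ℝ] TangentSpace (𝓡 n) q,
      ∀ v, extendVec v q = L v := by
  let t := trivializationAt (EuclideanSpace ℝ (Fin n)) (TangentSpace (𝓡 n) : M → Type _) p
  have hp := FiberBundle.mem_baseSet_trivializationAt' (F := EuclideanSpace ℝ (Fin n))
    (E := (TangentSpace (𝓡 n) : M → Type _)) p
  filter_upwards [t.open_baseSet.mem_nhds hp] with q hq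
  refine ⟨t.symmₗ ℝ q ∘ₗ t.linearMapAt ℝ p, fun v => ?_⟩
  rw [LinearMap.comp_apply, t.coe_linearMapAt_of_mem hp, t.symmₗ_apply hq]
  rfl

theorem extendVec_add (v w : TangentSpace (𝓡 n) p) :
    extendVec (v + w) =ᶠ[𝓝 p] extendVec v + extendVec w := by
  filter_upwards [eventually_extendVec_eq (n := n) p] with q ⟨L, hL⟩
  simp only [Pi.add_apply, hL, map_add]
  rfl

theorem extendVec_smul (c : ℝ) (v : TangentSpace (𝓡 n) p) :
    extendVec (c • v) =ᶠ[𝓝 p] (fun _ : M => c) • extendVec v := by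
  filter_upwards [eventually_extendVec_eq (n := n) p] with q ⟨L, hL⟩
  simp only [Pi.smul_apply', hL, map_smul]
  rfl

end Fields

/-! ### The Koszul formula and the Levi-Civita connection. -/

section LeviCivita

variable {n : ℕ} {M : Type*} [TopologicalSpace M]
  [ChartedSpace (EuclideanSpace ℝ (Fin n)) M]
  [Bundle.RiemannianBundle (fun p : M => TangentSpace (𝓡 n) p)]

variable {X X' Y Y' Z Z' W : VField n M} {f : M → ℝ} {p : M}

theorem metricFun_comm (X Y : VField n M) : metricFun X Y = metricFun Y X :=
  funext fun _ => real_inner_comm _ _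

theorem metricFun_add_left (X X' Y : VField n M) :
    metricFun (X + X') Y = metricFun X Y + metricFun X' Y :=
  funext fun _ => inner_add_left _ _ _

theorem metricFun_smul_left (f : M → ℝ) (X Y : VField n M) :
    metricFun (f • X) Y = f * metricFun X Y :=
  funext fun _ => real_inner_smul_left _ _ _

theorem metricFun_add_right (X Y Y' : VField n M) :
    metricFun X (Y + Y') = metricFun X Y + metricFun X Y' :=
  funext fun _ => inner_add_right _ _ _

theorem metricFun_smul_right (f : M → ℝ) (X Y : VField n M) :
    metricFun X (f • Y) = f * metricFun X Y :=
  funext fun _ => real_inner_smul_right _ _ _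

theorem metricFun_apply_congr {q : M} (hX : X q = X' q) (hY : Y q = Y' q) :
    metricFun X Y q = metricFun X' Y' q := by
  rw [metricFun, metricFun, hX, hY]

theorem koszul_congr (hX : X =ᶠ[𝓝 p] X') (hY : Y =ᶠ[𝓝 p] Y') (Z : VField n M) :
    koszul X Y Z p = koszul X' Y' Z p := by
  have h1 : metricFun Y Z =ᶠ[𝓝 p] metricFun Y' Z :=
    hY.mono fun q h => metricFun_apply_congr h rfl
  have h2 : metricFun Z X =ᶠ[𝓝 p] metricFun Z X' :=
    hX.mono fun q h => metricFun_apply_congr rfl h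
  have h3 : metricFun X Y =ᶠ[𝓝 p] metricFun X' Y' := by
    filter_upwards [hX, hY] with q h h' using metricFun_apply_congr h h'
  have hXp := hX.eq_of_nhds
  have hYp := hY.eq_of_nhds
  have d (A B : VField n M) (g : M → ℝ) (h : A p = B p) : dirDeriv A g p = dirDeriv B g p := by
    rw [dirDeriv, dirDeriv, h]
  simp only [koszul]
  rw [dirDeriv_congr h1, dirDeriv_congr h2, dirDeriv_congr h3, d X X' _ hXp, d Y Y' _ hYp]
  simp only [metricFun]
  rw [hX.mlieBracket_vectorField_eq hY, hY.mlieBracket_vectorField_eq (EventuallyEq.refl _ Z),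
    (EventuallyEq.refl _ Z).mlieBracket_vectorField_eq hX, hXp, hYp]

variable [IsManifold (𝓡 n) ∞ M]

theorem leviCivita_congr (hX : X =ᶠ[𝓝 p] X') (hY : Y =ᶠ[𝓝 p] Y') :
    leviCivita X Y p = leviCivita X' Y' p := by
  simp only [leviCivita, koszul_congr hX hY]

theorem leviCivita_eventuallyEq (hX : X =ᶠ[𝓝 p] X') (hY : Y =ᶠ[𝓝 p] Y') :
    leviCivita X Y =ᶠ[𝓝 p] leviCivita X' Y' := by
  filter_upwards [hX.eventuallyEq_nhds, hY.eventuallyEq_nhds] with q h h'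
    using leviCivita_congr h h'

/-- Differentiable test fields suffice because every vector has a differentiable extension. This
lets the rules for `leviCivita` be checked through the Koszul formula. -/
theorem eq_of_inner_vfield_eq {v w : TangentSpace (𝓡 n) p}
    (h : ∀ Z : VField n M, VFieldDiffAt Z p → inner ℝ v (Z p) = inner ℝ w (Z p)) : v = w :=
  ext_inner_right ℝ fun u => by simpa using h (extendVec u) (diffAt_extendVec u)

variable [IsContMDiffRiemannianBundle (𝓡 n) ∞ (EuclideanSpace ℝ (Fin n))
  (fun p : M => TangentSpace (𝓡 n) p)]

theorem diffAt_metricFun (hX : VFieldDiffAt X p) (hY : VFieldDiffAt Y p) :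
    FunDiffAt n (metricFun X Y) p :=
  have : IsContMDiffRiemannianBundle (𝓡 n) 1 (EuclideanSpace ℝ (Fin n))
      (fun p : M => TangentSpace (𝓡 n) p) :=
    IsContMDiffRiemannianBundle.of_le (n := ∞) ENat.LEInfty.out
  MDifferentiableAt.inner_bundle (E := fun p : M => TangentSpace (𝓡 n) p) hX hY

theorem contDiffAt_metricFun (hX : VFieldContDiffAt 2 X p) (hY : VFieldContDiffAt 2 Y p) :
    FunContDiffAt n 2 (metricFun X Y) p :=
  have : IsContMDiffRiemannianBundle (𝓡 n) 2 (EuclideanSpace ℝ (Fin n))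
      (fun p : M => TangentSpace (𝓡 n) p) :=
    IsContMDiffRiemannianBundle.of_le (n := ∞) ENat.LEInfty.out
  ContMDiffAt.inner_bundle (E := fun p : M => TangentSpace (𝓡 n) p) hX hY

theorem koszul_add_left (hX : VFieldDiffAt X p) (hX' : VFieldDiffAt X' p)
    (hY : VFieldDiffAt Y p) (hZ : VFieldDiffAt Z p) :
    koszul (X + X') Y Z p = koszul X Y Z p + koszul X' Y Z p := by
  have h1 := dirDeriv_add (X := Y) (diffAt_metricFun hZ hX) (diffAt_metricFun hZ hX')
  have h2 := dirDeriv_add (X := Z) (diffAt_metricFun hX hY) (diffAt_metricFun hX' hY)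
  simp only [koszul, metricFun_add_left, metricFun_add_right, h1, h2, dirDeriv_add_left]
  simp only [metricFun, mlieBracket_add_left hX hX', mlieBracket_add_right hX hX',
    inner_add_left, Pi.add_apply]
  ring

theorem koszul_smul_left (hf : FunDiffAt n f p) (hX : VFieldDiffAt X p)
    (hY : VFieldDiffAt Y p) (hZ : VFieldDiffAt Z p) :
    koszul (f • X) Y Z p = f p * koszul X Y Z p := by
  have h1 := dirDeriv_mul (X := Y) hf (diffAt_metricFun hZ hX)
  have h2 := dirDeriv_mul (X := Z) hf (diffAt_metricFun hX hY)
  simp only [koszul, metricFun_smul_left, metricFun_smul_right, h1, h2, dirDeriv_smul_left]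
  simp only [metricFun, mlieBracket_smul_left' hf hX, mlieBracket_smul_right' hf hX,
    inner_add_left, Pi.mul_apply, real_inner_smul_left,
    real_inner_comm (Y p) (X p), real_inner_comm (Z p) (X p)]
  ring

theorem koszul_add_middle (hX : VFieldDiffAt X p) (hY : VFieldDiffAt Y p)
    (hY' : VFieldDiffAt Y' p) (hZ : VFieldDiffAt Z p) :
    koszul X (Y + Y') Z p = koszul X Y Z p + koszul X Y' Z p := by
  have h1 := dirDeriv_add (X := X) (diffAt_metricFun hY hZ) (diffAt_metricFun hY' hZ)
  have h2 := dirDeriv_add (X := Z) (diffAt_metricFun hX hY) (diffAt_metricFun hX hY')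
  simp only [koszul, metricFun_add_left, metricFun_add_right, h1, h2, dirDeriv_add_left]
  simp only [metricFun, mlieBracket_add_left hY hY', mlieBracket_add_right hY hY',
    inner_add_left, Pi.add_apply]
  ring

theorem koszul_smul_middle (hf : FunDiffAt n f p) (hX : VFieldDiffAt X p)
    (hY : VFieldDiffAt Y p) (hZ : VFieldDiffAt Z p) :
    koszul X (f • Y) Z p =
      f p * koszul X Y Z p + 2 * dirDeriv X f p * metricFun Y Z p := by
  have h1 := dirDeriv_mul (X := X) hf (diffAt_metricFun hY hZ)
  have h2 := dirDeriv_mul (X := Z) hf (diffAt_metricFun hX hY)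
  simp only [koszul, metricFun_smul_left, metricFun_smul_right, h1, h2, dirDeriv_smul_left]
  simp only [metricFun, mlieBracket_smul_left' hf hY, mlieBracket_smul_right' hf hY,
    inner_add_left, Pi.mul_apply, real_inner_smul_left,
    real_inner_comm (Y p) (X p)]
  ring

/-- The derivatives of `f` from the metric terms and from the brackets cancel in the third slot.
Thus only `Z p` matters, and the expansion over `extendVec (onb p i)` that defines `leviCivita`
determines its product with any differentiable `Z`. -/
theorem koszul_tensorialAt (hX : VFieldDiffAt X p) (hY : VFieldDiffAt Y p) :
    TensorialAt (𝓡 n) (EuclideanSpace ℝ (Fin n)) (fun Z : VField n M => koszul X Y Z p) p where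
  smul := by
    intro f Z hf hZ
    have h1 := dirDeriv_mul (X := X) hf (diffAt_metricFun hY hZ)
    have h2 := dirDeriv_mul (X := Y) hf (diffAt_metricFun hZ hX)
    simp only [koszul, metricFun_smul_left, metricFun_smul_right, h1, h2, dirDeriv_smul_left]
    simp only [metricFun, mlieBracket_smul_left' hf hZ, mlieBracket_smul_right' hf hZ,
      inner_add_left, Pi.mul_apply, real_inner_smul_left,
      real_inner_comm (Z p) (Y p), smul_eq_mul]
    ring
  add := by
    intro Z Z' hZ hZ'
    have h1 := dirDeriv_add (X := X) (diffAt_metricFun hY hZ) (diffAt_metricFun hY hZ')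
    have h2 := dirDeriv_add (X := Y) (diffAt_metricFun hZ hX) (diffAt_metricFun hZ' hX)
    simp only [koszul, metricFun_add_left, metricFun_add_right, h1, h2, dirDeriv_add_left]
    simp only [metricFun, mlieBracket_add_left hZ hZ', mlieBracket_add_right hZ hZ',
      inner_add_left, Pi.add_apply]
    ring

/-- The Koszul formula. -/
theorem inner_leviCivita (hX : VFieldDiffAt X p) (hY : VFieldDiffAt Y p)
    (hZ : VFieldDiffAt Z p) :
    inner ℝ (leviCivita X Y p) (Z p) = 1 / 2 * koszul X Y Z p := by
  have T := koszul_tensorialAt hX hY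
  have h (v : TangentSpace (𝓡 n) p) : koszul X Y (extendVec v) p = T.mkHom _ p v := rfl
  rw [← T.mkHom_apply hZ, leviCivita, sum_inner]
  conv_rhs => rw [← (onb p).sum_repr (Z p)]
  rw [map_sum, Finset.mul_sum]
  refine Finset.sum_congr rfl fun i _ => ?_
  rw [real_inner_smul_left, h, map_smul, OrthonormalBasis.repr_apply_apply, smul_eq_mul]
  ring

theorem leviCivita_add_left (hX : VFieldDiffAt X p) (hX' : VFieldDiffAt X' p)
    (hY : VFieldDiffAt Y p) :
    leviCivita (X + X') Y p = leviCivita X Y p + leviCivita X' Y p :=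
  eq_of_inner_vfield_eq fun Z hZ => by
    rw [inner_add_left, inner_leviCivita (hX.add hX') hY hZ, inner_leviCivita hX hY hZ,
      inner_leviCivita hX' hY hZ, koszul_add_left hX hX' hY hZ, mul_add]

theorem leviCivita_smul_left (hf : FunDiffAt n f p) (hX : VFieldDiffAt X p)
    (hY : VFieldDiffAt Y p) :
    leviCivita (f • X) Y p = f p • leviCivita X Y p :=
  eq_of_inner_vfield_eq fun Z hZ => by
    rw [real_inner_smul_left, inner_leviCivita (hX.smul hf) hY hZ, inner_leviCivita hX hY hZ,
      koszul_smul_left hf hX hY hZ]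
    ring

theorem leviCivita_add_right (hX : VFieldDiffAt X p) (hY : VFieldDiffAt Y p)
    (hY' : VFieldDiffAt Y' p) :
    leviCivita X (Y + Y') p = leviCivita X Y p + leviCivita X Y' p :=
  eq_of_inner_vfield_eq fun Z hZ => by
    rw [inner_add_left, inner_leviCivita hX (hY.add hY') hZ, inner_leviCivita hX hY hZ,
      inner_leviCivita hX hY' hZ, koszul_add_middle hX hY hY' hZ, mul_add]

theorem leviCivita_smul_right (hf : FunDiffAt n f p) (hX : VFieldDiffAt X p)
    (hY : VFieldDiffAt Y p) :
    leviCivita X (f • Y) p = dirDeriv X f p • Y p + f p • leviCivita X Y p :=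
  eq_of_inner_vfield_eq fun Z hZ => by
    rw [inner_add_left, real_inner_smul_left, real_inner_smul_left,
      inner_leviCivita hX (hY.smul hf) hZ, inner_leviCivita hX hY hZ,
      koszul_smul_middle hf hX hY hZ, metricFun]
    ring

/-- The Levi-Civita connection is compatible with the metric. -/
theorem dirDeriv_metricFun (hX : VFieldDiffAt X p) (hY : VFieldDiffAt Y p)
    (hZ : VFieldDiffAt Z p) :
    dirDeriv X (metricFun Y Z) p =
      inner ℝ (leviCivita X Y p) (Z p) + inner ℝ (leviCivita X Z p) (Y p) := by
  rw [inner_leviCivita hX hY hZ, inner_leviCivita hX hZ hY]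
  simp only [koszul, metricFun_comm Y X, metricFun_comm Z X, metricFun_comm Z Y]
  simp only [metricFun, mlieBracket_swap_apply (V := Z) (W := X),
    mlieBracket_swap_apply (V := Y) (W := X), mlieBracket_swap_apply (V := Z) (W := Y),
    inner_neg_left]
  ring

end LeviCivita

/-! ### Invertibility of Gram matrices. -/

section GramMatrix

/-- The linear map given by a matrix, as a continuous linear function of the entries. -/
def mulVecCLM (n : ℕ) : (Fin n → Fin n → ℝ) →L[ℝ] (Fin n → ℝ) →L[ℝ] (Fin n → ℝ) :=
  LinearMap.toContinuousLinearMap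
    { toFun := fun A => LinearMap.toContinuousLinearMap (Matrix.toLin' (Matrix.of A))
      map_add' := fun A B => by rw [← Matrix.of_add_of, map_add, map_add]
      map_smul' := fun c A => by rw [← Matrix.smul_of, map_smul, map_smul]; rfl }

theorem mulVecCLM_apply {n : ℕ} (A : Fin n → Fin n → ℝ) (y : Fin n → ℝ) (i : Fin n) :
    mulVecCLM n A y i = ∑ j, A i j * y j := rfl

/-- If `y` is in the kernel, then `∑ i, y i • v i` has norm zero, so `y = 0` by independence;
injectivity is enough in finite dimension. -/
theorem isInvertible_mulVecCLM_gram {n : ℕ} {E : Type*} [NormedAddCommGroup E]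
    [InnerProductSpace ℝ E] {v : Fin n → E} (hv : LinearIndependent ℝ v) :
    (mulVecCLM n (fun i j => inner ℝ (v i) (v j))).IsInvertible := by
  have hinj : Function.Injective (mulVecCLM n (fun i j => inner ℝ (v i) (v j))) := by
    rw [injective_iff_map_eq_zero]
    intro y hy
    have h0 : inner ℝ (∑ i, y i • v i) (∑ j, y j • v j) = 0 := by
      rw [sum_inner]
      refine Finset.sum_eq_zero fun i _ => ?_
      have := congrFun hy i
      rw [mulVecCLM_apply] at this
      rw [real_inner_smul_left, inner_sum]
      simp only [real_inner_smul_right, mul_comm (y _) (inner ℝ _ _)]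
      rw [this]; simp
    funext i
    exact Fintype.linearIndependent_iff.1 hv y (inner_self_eq_zero.1 h0) i
  exact ⟨(LinearEquiv.ofInjectiveEndo
    (mulVecCLM n (fun i j => inner ℝ (v i) (v j))).toLinearMap hinj).toContinuousLinearEquiv,
    by ext; rfl⟩

end GramMatrix

theorem mdifferentiableAt_pi_of_forall {n : ℕ} {M : Type*} [TopologicalSpace M]
    [ChartedSpace (EuclideanSpace ℝ (Fin n)) M] {p : M} {ι : Type*} [Fintype ι]
    {E : Type*} [NormedAddCommGroup E] [NormedSpace ℝ E] {F : M → ι → E}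
    (h : ∀ i, MDifferentiableAt (𝓡 n) 𝓘(ℝ, E) (fun q => F q i) p) :
    MDifferentiableAt (𝓡 n) 𝓘(ℝ, ι → E) F p := by
  rw [mdifferentiableAt_iff]
  exact ⟨continuousAt_pi.2 fun i => (h i).continuousAt,
    differentiableWithinAt_pi.2 fun i => ((mdifferentiableAt_iff _ _).1 (h i)).2⟩

/-! ### Differentiability of the connection, symmetries of the curvature, scalar curvature. -/

section Curvature

variable {n : ℕ} {M : Type*} [TopologicalSpace M]
  [ChartedSpace (EuclideanSpace ℝ (Fin n)) M] [IsManifold (𝓡 n) ∞ M]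
  [Bundle.RiemannianBundle (fun p : M => TangentSpace (𝓡 n) p)]

variable {X X' Y Z W V : VField n M} {p : M}

theorem curvField_congr_left (h : X =ᶠ[𝓝 p] X') :
    curvField X Y Z p = curvField X' Y Z p := by
  have e (V : VField n M) := EventuallyEq.refl (𝓝 p) V
  simp only [curvField, Pi.sub_apply]
  rw [leviCivita_congr h (e _), leviCivita_congr (e _) (leviCivita_eventuallyEq h (e Z)),
    leviCivita_congr (h.mlieBracket_vectorField (e Y)) (e Z)]

variable [IsContMDiffRiemannianBundle (𝓡 n) ∞ (EuclideanSpace ℝ (Fin n))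
  (fun p : M => TangentSpace (𝓡 n) p)]

/-- A vector field is differentiable as soon as its products with differentiable fields are. -/
theorem VFieldDiffAt.of_metricFun
    (h : ∀ W : VField n M, VFieldContDiffAt 2 W p → FunDiffAt n (metricFun W V) p) :
    VFieldDiffAt V p := by
  let t := trivializationAt (EuclideanSpace ℝ (Fin n)) (TangentSpace (𝓡 n) : M → Type _) p
  have hp : p ∈ t.baseSet := FiberBundle.mem_baseSet_trivializationAt' p
  have ht := t.open_baseSet.mem_nhds hp
  let b := (EuclideanSpace.basisFun (Fin n) ℝ).toBasis
  let s : Fin n → VField n M := t.localFrame b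
  let c : Fin n → M → ℝ := fun i q => t.localFrameCoeff (𝓡 n) b i q (V q)
  have hs (i : Fin n) : VFieldContDiffAt 2 (s i) p := contMDiffAt_localFrame_of_mem 2 t b i hp
  let G : M → Fin n → Fin n → ℝ := fun q i j => metricFun (s i) (s j) q
  let u : M → Fin n → ℝ := fun q i => metricFun (s i) V q
  have hli {q : M} (hq : q ∈ t.baseSet) : LinearIndependent ℝ fun i => s i q :=
    (t.isLocalFrameOn_localFrame_baseSet (𝓡 n) 1 b).linearIndependent hq
  have hinv {q : M} (hq : q ∈ t.baseSet) : (mulVecCLM n (G q)).IsInvertible :=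
    isInvertible_mulVecCLM_gram (hli hq)
  -- The coefficients of `V` in a local frame solve the linear system given by the Gram matrix of
  -- the frame and the products `g(s i, V)`. Since inversion of operators is differentiable at
  -- invertible ones, the coefficients are differentiable.
  have hsolve {q : M} (hq : q ∈ t.baseSet) : mulVecCLM n (G q) (fun i => c i q) = u q := by
    funext i
    rw [mulVecCLM_apply]
    have e := t.eq_sum_localFrameCoeff_smul (I := 𝓡 n) (b := b) (s := V) hq
    change _ = inner ℝ (s i q) (V q)
    rw [e, inner_sum]
    refine Finset.sum_congr rfl fun j _ => ?_
    rw [real_inner_smul_right, mul_comm]; rfl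
  have hc : (fun q i => c i q) =ᶠ[𝓝 p] fun q => (mulVecCLM n (G q)).inverse (u q) := by
    filter_upwards [ht] with q hq
    rw [← hsolve hq, (hinv hq).inverse_apply_eq.2 rfl]
  have hG : MDifferentiableAt (𝓡 n) 𝓘(ℝ, Fin n → Fin n → ℝ) G p :=
    mdifferentiableAt_pi_of_forall fun i => mdifferentiableAt_pi_of_forall fun j =>
      diffAt_metricFun (hs i).diffAt (hs j).diffAt
  have hu : MDifferentiableAt (𝓡 n) 𝓘(ℝ, Fin n → ℝ) u p :=
    mdifferentiableAt_pi_of_forall fun i => h (s i) (hs i)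
  have hI : MDifferentiableAt (𝓡 n) 𝓘(ℝ, (Fin n → ℝ) →L[ℝ] (Fin n → ℝ))
      (fun q => (mulVecCLM n (G q)).inverse) p := by
    obtain ⟨e, he⟩ := hinv hp
    have h1 : DifferentiableAt ℝ (fun A => (mulVecCLM n A).inverse) (G p) :=
      ((he ▸ contDiffAt_map_inverse (n := 1) e).differentiableAt one_ne_zero).comp (G p)
        (mulVecCLM n).differentiableAt
    exact h1.comp_mdifferentiableAt hG
  have hcd : MDifferentiableAt (𝓡 n) 𝓘(ℝ, Fin n → ℝ) (fun q i => c i q) p :=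
    (hI.clm_apply hu).congr_of_eventuallyEq hc
  refine (t.isLocalFrameOn_localFrame_baseSet (𝓡 n) 1 b).mdifferentiableAt_of_coeff
    (fun i => ?_) ht
  exact (ContinuousLinearMap.proj (R := ℝ) (φ := fun _ : Fin n => ℝ)
    i).differentiableAt.comp_mdifferentiableAt hcd

theorem diffAt_koszul (hX : VFieldContDiffAt 2 X p) (hY : VFieldContDiffAt 2 Y p)
    (hZ : VFieldContDiffAt 2 Z p) : FunDiffAt n (koszul X Y Z) p := by
  have d {A B C : VField n M} (hA : VFieldContDiffAt 2 A p) (hB : VFieldContDiffAt 2 B p)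
      (hC : VFieldContDiffAt 2 C p) : FunDiffAt n (dirDeriv A (metricFun B C)) p :=
    diffAt_dirDeriv hA.diffAt (contDiffAt_metricFun hB hC)
  have e {A B C : VField n M} (hA : VFieldContDiffAt 2 A p) (hB : VFieldContDiffAt 2 B p)
      (hC : VFieldContDiffAt 2 C p) :
      FunDiffAt n (metricFun (mlieBracket (𝓡 n) A B) C) p :=
    diffAt_metricFun (diffAt_mlieBracket hA hB) hC.diffAt
  exact (((((d hX hY hZ).add (d hY hZ hX)).sub (d hZ hX hY)).add (e hX hY hZ)).sub
    (e hY hZ hX)).add (e hZ hX hY)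

/-- The bases `onb q` need not vary continuously with `q`, so the defining sum gives no regularity.
The products with `C^2` fields do: they are Koszul expressions. -/
theorem diffAt_leviCivita (hX : VFieldContDiffAt 2 X p) (hY : VFieldContDiffAt 2 Y p) :
    VFieldDiffAt (leviCivita X Y) p := by
  refine VFieldDiffAt.of_metricFun fun W hW => ?_
  have h : metricFun W (leviCivita X Y) =ᶠ[𝓝 p] fun q => (1 / 2 : ℝ) * koszul X Y W q := by
    filter_upwards [hX.eventually, hY.eventually, hW.eventually] with q h1 h2 h3
    rw [metricFun_comm]
    exact inner_leviCivita h1.diffAt h2.diffAt h3.diffAt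
  have hk := diffAt_koszul hX hY hW
  exact (mdifferentiableAt_const.mul hk).congr_of_eventuallyEq h

theorem dirDeriv_dirDeriv_metricFun (hX : VFieldContDiffAt 2 X p) (hY : VFieldContDiffAt 2 Y p)
    (hZ : VFieldContDiffAt 2 Z p) (hW : VFieldContDiffAt 2 W p) :
    dirDeriv X (dirDeriv Y (metricFun Z W)) p =
      inner ℝ (leviCivita X (leviCivita Y Z) p) (W p)
        + inner ℝ (leviCivita X W p) (leviCivita Y Z p)
        + (inner ℝ (leviCivita X (leviCivita Y W) p) (Z p)
        + inner ℝ (leviCivita X Z p) (leviCivita Y W p)) := by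
  have h : dirDeriv Y (metricFun Z W) =ᶠ[𝓝 p]
      metricFun (leviCivita Y Z) W + metricFun (leviCivita Y W) Z := by
    filter_upwards [hY.eventually, hZ.eventually, hW.eventually] with q h1 h2 h3
    exact dirDeriv_metricFun h1.diffAt h2.diffAt h3.diffAt
  have dZ := diffAt_leviCivita hY hZ
  have dW := diffAt_leviCivita hY hW
  rw [dirDeriv_congr h, dirDeriv_add (diffAt_metricFun dZ hW.diffAt)
    (diffAt_metricFun dW hZ.diffAt), dirDeriv_metricFun hX.diffAt dZ hW.diffAt,
    dirDeriv_metricFun hX.diffAt dW hZ.diffAt]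

/-- Apply `[X, Y] = XY - YX` to the function `g(Z, W)` and expand by metric compatibility; the
products of two first covariant derivatives are symmetric in `X`, `Y` and cancel. -/
theorem inner_curvField_antisymm (hX : VFieldContDiffAt 2 X p) (hY : VFieldContDiffAt 2 Y p)
    (hZ : VFieldContDiffAt 2 Z p) (hW : VFieldContDiffAt 2 W p) :
    inner ℝ (curvField X Y Z p) (W p) = - inner ℝ (curvField X Y W p) (Z p) := by
  have h1 := dirDeriv_dirDeriv_metricFun hX hY hZ hW
  have h2 := dirDeriv_dirDeriv_metricFun hY hX hZ hW
  have h3 := dirDeriv_metricFun (diffAt_mlieBracket hX hY) hZ.diffAt hW.diffAt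
  have h4 := dirDeriv_mlieBracket hX hY (contDiffAt_metricFun hZ hW)
  simp only [curvField, Pi.sub_apply, inner_sub_left]
  rw [real_inner_comm (leviCivita X Z p)] at h2
  rw [real_inner_comm (leviCivita X W p)] at h2
  linarith

theorem curvField_add_left (hX : VFieldContDiffAt 2 X p) (hX' : VFieldContDiffAt 2 X' p)
    (hY : VFieldContDiffAt 2 Y p) (hZ : VFieldContDiffAt 2 Z p) :
    curvField (X + X') Y Z p = curvField X Y Z p + curvField X' Y Z p := by
  have h1 : leviCivita (X + X') Z =ᶠ[𝓝 p] leviCivita X Z + leviCivita X' Z := by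
    filter_upwards [hX.eventually, hX'.eventually, hZ.eventually] with q h h' h''
    exact leviCivita_add_left h.diffAt h'.diffAt h''.diffAt
  have h2 : mlieBracket (𝓡 n) (X + X') Y =ᶠ[𝓝 p]
      mlieBracket (𝓡 n) X Y + mlieBracket (𝓡 n) X' Y := by
    filter_upwards [hX.eventually, hX'.eventually] with q h h'
    exact mlieBracket_add_left h.diffAt h'.diffAt
  simp only [curvField, Pi.sub_apply]
  rw [leviCivita_congr (EventuallyEq.refl _ Y) h1, leviCivita_congr h2 (EventuallyEq.refl _ Z),
    leviCivita_add_left hX.diffAt hX'.diffAt (diffAt_leviCivita hY hZ),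
    leviCivita_add_right hY.diffAt (diffAt_leviCivita hX hZ) (diffAt_leviCivita hX' hZ),
    leviCivita_add_left (diffAt_mlieBracket hX hY) (diffAt_mlieBracket hX' hY) hZ.diffAt]
  abel

theorem curvField_const_smul_left (c : ℝ) (hX : VFieldContDiffAt 2 X p)
    (hY : VFieldContDiffAt 2 Y p) (hZ : VFieldContDiffAt 2 Z p) :
    curvField ((fun _ : M => c) • X) Y Z p = c • curvField X Y Z p := by
  have hc (q : M) : FunDiffAt n (fun _ : M => c) q := mdifferentiableAt_const
  have h1 : leviCivita ((fun _ : M => c) • X) Z =ᶠ[𝓝 p] (fun _ : M => c) • leviCivita X Z := by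
    filter_upwards [hX.eventually, hZ.eventually] with q h h''
    exact leviCivita_smul_left (hc q) h.diffAt h''.diffAt
  have h2 : mlieBracket (𝓡 n) ((fun _ : M => c) • X) Y =ᶠ[𝓝 p]
      (fun _ : M => c) • mlieBracket (𝓡 n) X Y := by
    filter_upwards [hX.eventually] with q h
    rw [mlieBracket_smul_left' (hc q) h.diffAt, dirDeriv_const, neg_zero, zero_smul, zero_add]
    rfl
  simp only [curvField, Pi.sub_apply]
  rw [leviCivita_congr (EventuallyEq.refl _ Y) h1, leviCivita_congr h2 (EventuallyEq.refl _ Z),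
    leviCivita_smul_left (hc p) hX.diffAt (diffAt_leviCivita hY hZ),
    leviCivita_smul_right (hc p) hY.diffAt (diffAt_leviCivita hX hZ),
    leviCivita_smul_left (hc p) (diffAt_mlieBracket hX hY) hZ.diffAt, dirDeriv_const]
  module

theorem curvField_swap (hX : VFieldContDiffAt 2 X p) (hY : VFieldContDiffAt 2 Y p)
    (hZ : VFieldContDiffAt 2 Z p) : curvField X Y Z p = - curvField Y X Z p := by
  have h : mlieBracket (𝓡 n) X Y = (fun _ : M => (-1 : ℝ)) • mlieBracket (𝓡 n) Y X := by
    rw [mlieBracket_swap]; funext q; simp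
  simp only [curvField, Pi.sub_apply]
  rw [h, leviCivita_smul_left mdifferentiableAt_const (diffAt_mlieBracket hY hX) hZ.diffAt]
  module

variable (x x' y z w : TangentSpace (𝓡 n) p)

theorem curv_add_left : curv p (x + x') y z = curv p x y z + curv p x' y z := by
  rw [curv, curvField_congr_left (extendVec_add x x'), curvField_add_left] <;>
    first | exact contDiffAt_extendVec _ | rfl

theorem curv_smul_left (c : ℝ) : curv p (c • x) y z = c • curv p x y z := by
  rw [curv, curvField_congr_left (extendVec_smul c x), curvField_const_smul_left] <;>
    first | exact contDiffAt_extendVec _ | rfl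

theorem curv_swap : curv p x y z = - curv p y x z :=
  curvField_swap (contDiffAt_extendVec x) (contDiffAt_extendVec y) (contDiffAt_extendVec z)

theorem curv4_swap_right : curv4 p x y z w = - curv4 p x y w z := by
  have := inner_curvField_antisymm (contDiffAt_extendVec x) (contDiffAt_extendVec y)
    (contDiffAt_extendVec z) (contDiffAt_extendVec w)
  rwa [extendVec_self, extendVec_self] at this

theorem curv4_swap_left : curv4 p x y z w = - curv4 p y x z w := by
  rw [curv4, curv_swap, inner_neg_left, curv4]

/-- The endomorphism `x ↦ R(x, y) z`. -/
def curvEnd (y z : TangentSpace (𝓡 n) p) : TangentSpace (𝓡 n) p →ₗ[ℝ] TangentSpace (𝓡 n) p where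
  toFun x := curv p x y z
  map_add' x x' := curv_add_left x x' y z
  map_smul' c x := curv_smul_left x y z c

variable {ι κ : Type*} [Fintype ι] [Fintype κ]

theorem sum_curv4_eq_trace (b : OrthonormalBasis ι ℝ (TangentSpace (𝓡 n) p)) :
    ∑ i, curv4 p (b i) y z (b i) = LinearMap.trace ℝ _ (curvEnd y z) := by
  rw [LinearMap.trace_eq_sum_inner _ b]
  exact Finset.sum_congr rfl fun i _ => real_inner_comm _ _

theorem sum_curv4_eq (b : OrthonormalBasis ι ℝ (TangentSpace (𝓡 n) p))
    (e : OrthonormalBasis κ ℝ (TangentSpace (𝓡 n) p)) :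
    ∑ i, curv4 p (b i) y z (b i) = ∑ i, curv4 p (e i) y z (e i) := by
  rw [sum_curv4_eq_trace y z b, sum_curv4_eq_trace y z e]

/-- The scalar curvature in an arbitrary orthonormal basis. -/
theorem scalarCurv_eq_sum (b : OrthonormalBasis ι ℝ (TangentSpace (𝓡 n) p)) :
    scalarCurv n p = ∑ i, ∑ j, curv4 p (b i) (b j) (b j) (b i) := by
  have h1 : scalarCurv n p =
      ∑ i, ∑ j, curv4 (n := n) p (onb p j) (onb p i) (onb p i) (onb p j) := by
    simp only [scalarCurv, ricciOp, sum_inner, real_inner_smul_left,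
      orthonormal_iff_ite.1 (onb p).orthonormal, mul_ite, mul_one, mul_zero, Finset.sum_ite_eq',
      Finset.mem_univ, if_true, ricci]
  have h2 (x y : TangentSpace (𝓡 n) p) :
      curv4 (n := n) p x y y x = curv4 p y x x y := by
    rw [curv4_swap_left, curv4_swap_right, neg_neg]
  -- The basis is changed in one index at a time, each inner sum being a trace; `h2` brings the
  -- other index into the position of the trace.
  rw [h1]
  simp only [fun v => sum_curv4_eq v v (onb p) b]
  rw [Finset.sum_comm]
  refine Finset.sum_congr rfl fun i _ => ?_
  simp only [h2 (b i)]
  exact sum_curv4_eq _ _ (onb p) b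

end Curvature

/-! ### Algebra of almost contact metric structures and of the tensor `h`. -/

section AlmostContact

variable {n : ℕ} {M : Type*} [TopologicalSpace M]
  [ChartedSpace (EuclideanSpace ℝ (Fin n)) M] [IsManifold (𝓡 n) ∞ M]

variable {φ : EndField n M} {ξ : VField n M} {η : OneForm n M} {X : VField n M} {p : M}

/-- The vector field `φ X`. -/
def applyField (φ : EndField n M) (X : VField n M) : VField n M := fun q => φ q (X q)

theorem diffAt_applyField (hφ : SmoothEndField φ) (hX : VFieldDiffAt X p) :
    VFieldDiffAt (applyField φ X) p :=
  MDifferentiableAt.clm_bundle_apply (F₁ := EuclideanSpace ℝ (Fin n))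
    (F₂ := EuclideanSpace ℝ (Fin n)) (E₁ := fun q : M => TangentSpace (𝓡 n) q)
    (E₂ := fun q : M => TangentSpace (𝓡 n) q)
    ((hφ p).mdifferentiableAt (by simp)) hX

/-- The expression `[ξ, φ X] - φ [ξ, X]` is tensorial in `X`. -/
theorem tensorialAt_lieDeriv (hφ : SmoothEndField φ) (ξ : VField n M) (p : M) :
    TensorialAt (𝓡 n) (EuclideanSpace ℝ (Fin n))
      (fun X : VField n M => mlieBracket (𝓡 n) ξ (applyField φ X) p
        - φ p (mlieBracket (𝓡 n) ξ X p)) p where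
  smul := by
    intro f X hf hX
    have h : applyField φ (f • X) = f • applyField φ X := funext fun q => map_smul (φ q) _ _
    rw [h, mlieBracket_smul_right' hf (diffAt_applyField hφ hX), mlieBracket_smul_right' hf hX,
      map_add, map_smul, map_smul, applyField]
    module
  add := by
    intro X Y hX hY
    have h : applyField φ (X + Y) = applyField φ X + applyField φ Y :=
      funext fun q => map_add (φ q) _ _
    rw [h, mlieBracket_add_right (diffAt_applyField hφ hX) (diffAt_applyField hφ hY),
      mlieBracket_add_right hX hY, map_add]
    abel

variable [Bundle.RiemannianBundle (fun p : M => TangentSpace (𝓡 n) p)]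

namespace IsAlmostContactMetric

/-- Since `φ² ξ = 0`, the formula for `φ²` at `φ ξ` gives `φ ξ = c ξ` with `c = η(φ ξ)`. Applying
`φ` and then `η` yields `c² = 0`. -/
theorem phi_xi (hS : IsAlmostContactMetric φ ξ η) (p : M) : φ p (ξ p) = 0 := by
  have h1 : φ p (φ p (ξ p)) = 0 := by rw [hS.phi_sq, hS.eta_xi, one_smul, neg_add_cancel]
  have h2 := hS.phi_sq p (φ p (ξ p))
  rw [h1, map_zero] at h2
  have h3 : φ p (ξ p) = η p (φ p (ξ p)) • ξ p := (neg_add_eq_zero.1 h2.symm)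
  have h4 := congrArg (fun v => η p (φ p v)) h3
  simp only [h1, map_zero, map_smul, smul_eq_mul] at h4
  rw [h3, mul_self_eq_zero.1 h4.symm, zero_smul]

theorem eta_eq_inner (hS : IsAlmostContactMetric φ ξ η) (p : M)
    (x : TangentSpace (𝓡 n) p) : η p x = inner ℝ x (ξ p) := by
  have h := hS.metric_phi p x (ξ p)
  rw [hS.phi_xi, inner_zero_right, hS.eta_xi] at h
  linarith

theorem eta_phi (hS : IsAlmostContactMetric φ ξ η) (p : M)
    (x : TangentSpace (𝓡 n) p) : η p (φ p x) = 0 := by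
  have h1 := (congrArg (φ p) (hS.phi_sq p x)).symm.trans (hS.phi_sq p (φ p x))
  rw [map_add, map_neg, map_smul, hS.phi_xi, smul_zero, add_zero, left_eq_add] at h1
  have h2 := congrArg (η p) h1
  rwa [map_smul, hS.eta_xi, map_zero, smul_eq_mul, mul_one] at h2

theorem inner_phi_left (hS : IsAlmostContactMetric φ ξ η) (p : M) (x y : TangentSpace (𝓡 n) p) :
    inner ℝ (φ p x) y = - inner ℝ x (φ p y) := by
  have h := hS.metric_phi p x (φ p y)
  rw [hS.phi_sq, hS.eta_phi, inner_add_right, inner_neg_right, real_inner_smul_right,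
    ← hS.eta_eq_inner, hS.eta_phi] at h
  linarith

variable [IsContMDiffRiemannianBundle (𝓡 n) ∞ (EuclideanSpace ℝ (Fin n))
  (fun p : M => TangentSpace (𝓡 n) p)]

/-- Expand `2 h φ X = [ξ, φ² X] - φ [ξ, φ X]` with `φ² = -1 + η ⊗ ξ` and compare with `2 φ h X`. The
multiple of `ξ` left over is harmless, as only products with vectors orthogonal to `ξ` are taken. -/
theorem hTensor_phi (hS : IsAlmostContactMetric φ ξ η) (p : M) (x : TangentSpace (𝓡 n) p) :
    ∃ c : ℝ, hTensor φ ξ p (φ p x) = - φ p (hTensor φ ξ p x) + c • ξ p := by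
  let E : VField n M := extendVec x
  have hE : VFieldDiffAt E p := diffAt_extendVec x
  have hφE := diffAt_applyField hS.smooth_phi hE
  have hξ : VFieldDiffAt ξ p := (hS.smooth_xi p).mdifferentiableAt (by simp)
  -- `hTensor` at `φ x` uses the extension of `φ x`; tensoriality replaces it by `φ` applied to the
  -- extension of `x`, for which `φ²` can be used.
  have h1 := (tensorialAt_lieDeriv hS.smooth_phi ξ p).pointwise (diffAt_extendVec (φ p x)) hφE
    (by rw [extendVec_self, applyField]; exact congrArg (φ p) (extendVec_self x).symm)
  have hsq : applyField φ (applyField φ E) =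
      (fun _ : M => (-1 : ℝ)) • E + metricFun E ξ • ξ := by
    funext q
    simp only [applyField, hS.phi_sq, hS.eta_eq_inner, Pi.add_apply, Pi.smul_apply', metricFun]
    module
  have hc : FunDiffAt n (fun _ : M => (-1 : ℝ)) p := mdifferentiableAt_const
  have hm := diffAt_metricFun hE hξ
  rw [hsq, mlieBracket_add_right (VFieldDiffAt.smul hc hE) (VFieldDiffAt.smul hm hξ),
    mlieBracket_smul_right' hc hE, mlieBracket_smul_right' hm hξ, mlieBracket_self,
    dirDeriv_const] at h1
  -- The first term comes from `[ξ, η(E) ξ]`, the second from `φ² [ξ, E]`.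
  refine ⟨(1 / 2 : ℝ) * (dirDeriv ξ (metricFun E ξ) p - η p (mlieBracket (𝓡 n) ξ E p)), ?_⟩
  have h2 : hTensor φ ξ p (φ p x) = (1 / 2 : ℝ) • _ := congrArg (fun v => (1 / 2 : ℝ) • v) h1
  rw [h2]
  have h3 : hTensor φ ξ p x = (1 / 2 : ℝ) • (mlieBracket (𝓡 n) ξ (applyField φ E) p
    - φ p (mlieBracket (𝓡 n) ξ E p)) := rfl
  rw [h3, map_smul, map_sub, hS.phi_sq, Pi.zero_apply]
  module

theorem inner_hTensor_phi (hS : IsAlmostContactMetric φ ξ η) {p : M}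
    {x : TangentSpace (𝓡 n) p} (hx : inner ℝ x (ξ p) = 0) :
    inner ℝ (hTensor φ ξ p (φ p x)) (φ p x) = - inner ℝ (hTensor φ ξ p x) x := by
  obtain ⟨c, hc⟩ := hS.hTensor_phi p x
  have h1 : inner ℝ (ξ p) (φ p x) = 0 := by
    rw [real_inner_comm, ← hS.eta_eq_inner, hS.eta_phi]
  rw [hc, inner_add_left, inner_neg_left, real_inner_smul_left, h1, hS.metric_phi,
    hS.eta_eq_inner p x, hx]
  ring

theorem inner_phi_hTensor_phi (hS : IsAlmostContactMetric φ ξ η) {p : M}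
    {x : TangentSpace (𝓡 n) p} (hx : inner ℝ x (ξ p) = 0) :
    inner ℝ (φ p (hTensor φ ξ p (φ p x))) (φ p x) = - inner ℝ (φ p (hTensor φ ξ p x)) x := by
  obtain ⟨c, hc⟩ := hS.hTensor_phi p x
  rw [hS.metric_phi, hS.eta_eq_inner p x, hx, hc, inner_add_left, inner_neg_left,
    real_inner_smul_left, real_inner_comm x (ξ p), hx]
  ring

end IsAlmostContactMetric

end AlmostContact

end ContactMetric

end

/-! ### The φ-sectional curvature in dimension three. -/

theorem proposition3p2
    {M : Type*} [TopologicalSpace M] [ChartedSpace (EuclideanSpace ℝ (Fin 3)) M]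
    [IsManifold (𝓡 3) ∞ M]
    [Bundle.RiemannianBundle (fun p : M => TangentSpace (𝓡 3) p)]
    [IsContMDiffRiemannianBundle (𝓡 3) ∞ (EuclideanSpace ℝ (Fin 3))
      (fun p : M => TangentSpace (𝓡 3) p)]
    (φ : ContactMetric.EndField 3 M) (ξ : ContactMetric.VField 3 M)
    (η : ContactMetric.OneForm 3 M) (κ μ ν : M → ℝ)
    (hM : ContactMetric.IsKappaMuNu φ ξ η κ μ ν) (hκ : ∀ p, κ p < 1) :
    ∀ (p : M) (x : TangentSpace (𝓡 3) p), ‖x‖ = 1 → inner ℝ x (ξ p) = 0 →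
      ContactMetric.phiSectionalCurv φ p x = ContactMetric.scalarCurv 3 p / 2 - 2 * κ p := by
  open ContactMetric in
  intro p x hx hxξ
  have hS : IsAlmostContactMetric φ ξ η := hM.toIsAlmostContactMetric
  have hηx : η p x = 0 := by rw [hS.eta_eq_inner, hxξ]
  have hxx : inner ℝ x x = (1 : ℝ) := by rw [real_inner_self_eq_norm_sq, hx, one_pow]
  have hff : inner ℝ (φ p x) (φ p x) = (1 : ℝ) := by rw [hS.metric_phi, hηx, hxx]; ring
  have hxf : inner ℝ x (φ p x) = (0 : ℝ) := by
    have := hS.inner_phi_left p x x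
    rw [real_inner_comm] at this
    linarith
  have hfξ : inner ℝ (φ p x) (ξ p) = (0 : ℝ) := by rw [← hS.eta_eq_inner, hS.eta_phi]
  have hξξ : inner ℝ (ξ p) (ξ p) = (1 : ℝ) := by rw [← hS.eta_eq_inner, hS.eta_xi]
  have hnorm {v : TangentSpace (𝓡 3) p} (hv : inner ℝ v v = (1 : ℝ)) : ‖v‖ = 1 := by
    rw [norm_eq_sqrt_real_inner, hv, Real.sqrt_one]
  have horth : Orthonormal ℝ ![x, φ p x, ξ p] := by
    rw [orthonormal_iff_ite]
    intro i j
    fin_cases i <;> fin_cases j <;>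
      simp [hx, hnorm hff, hnorm hξξ, hxf, hfξ, hxξ, real_inner_comm x, real_inner_comm (φ p x)]
  have hrank : Fintype.card (Fin 3) = Module.finrank ℝ (TangentSpace (𝓡 3) p) :=
    (finrank_euclideanSpace (𝕜 := ℝ) (ι := Fin 3)).symm
  let b : OrthonormalBasis (Fin 3) ℝ (TangentSpace (𝓡 3) p) :=
    (basisOfOrthonormalOfCardEqFinrank horth hrank).toOrthonormalBasis
      (by rwa [coe_basisOfOrthonormalOfCardEqFinrank])
  have hb : ⇑b = ![x, φ p x, ξ p] := by
    rw [Module.Basis.coe_toOrthonormalBasis, coe_basisOfOrthonormalOfCardEqFinrank]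
  have hself (y : TangentSpace (𝓡 3) p) : curv4 p y y y y = 0 := by
    have := curv4_swap_left y y y y
    linarith
  have hsymm (y z : TangentSpace (𝓡 3) p) : curv4 p y z z y = curv4 p z y y z := by
    rw [curv4_swap_left, curv4_swap_right, neg_neg]
  have hR (y : TangentSpace (𝓡 3) p) (hy : inner ℝ y (ξ p) = 0) (h1 : inner ℝ y y = (1 : ℝ)) :
      curv4 p y (ξ p) (ξ p) y = κ p + μ p * inner ℝ (hTensor φ ξ p y) y
        + ν p * inner ℝ (φ p (hTensor φ ξ p y)) y := by
    rw [curv4, hM.curv_xi, hS.eta_eq_inner p y, hy, hS.eta_xi]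
    simp only [one_smul, zero_smul, sub_zero, inner_add_left, real_inner_smul_left, h1, mul_one]
  have hsum := scalarCurv_eq_sum b
  simp only [hb, Fin.sum_univ_three, Matrix.cons_val_zero, Matrix.cons_val_one,
    Matrix.cons_val, hself] at hsum
  -- Each plane occurs twice in the sum. After the sign changes under `x ↦ φ x`, the `μ` and `ν`
  -- terms of the two planes containing `ξ` cancel, leaving `τ = 2F + 4κ`.
  rw [hsymm (φ p x) x, hsymm (ξ p) x, hsymm (ξ p) (φ p x), hR x hxξ hxx, hR _ hfξ hff,
    hS.inner_hTensor_phi hxξ, hS.inner_phi_hTensor_phi hxξ] at hsum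
  rw [phiSectionalCurv, hsum]
  ring
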